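/- All groups are abelian and written additively. A group $G$ is *co-Hopfian* if every injective endomorphism of $G$ is surjective. It is *relatively co-Hopfian* if it is not isomorphic to a proper direct summand of any proper subgroup of $G$. A group is *reduced* if its only divisible subgroup is $\{0\}$. A torsion group $T$ is *quotient reduced co-Hopfian* if every injective endomorphism $\phi : T \to T$ for which $T/\phi(T)$ is reduced is surjective. A group $G$ is *cotorsion* if $\operatorname{Ext}(J, G) = 0$ for every torsion-free group $J$; a cotorsion group is *adjusted* if it is reduced and has no nonzero torsion-free direct summand. **Proposition.** Let $G$ be an adjusted cotorsion group and let $T$ be its torsion subgroup. Then $G \cong \operatorname{Ext}(\mathbb{Q}/\mathbb{Z}, T)$, and the following three conditions are equivalent: (a) $G$ is co-Hopfian; (b) $G$ is relatively co-Hopfian; (c) $T$ is quotient reduced co-Hopfian. -/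

import Mathlib

open CategoryTheory

universe u

/-- An abelian group is co-Hopfian if every injective endomorphism is surjective. -/
def IsCoHopfian (G : Type*) [AddCommGroup G] : Prop :=
  ∀ φ : G →+ G, Function.Injective φ → Function.Surjective φ

/-- An abelian group `G` is relatively co-Hopfian if it is not isomorphic to a proper direct
summand `A` of any proper subgroup `H = A ⊕ B` of `G`. -/
def IsRelativelyCoHopfian (G : Type*) [AddCommGroup G] : Prop :=
  ∀ H A B : AddSubgroup G, H ≠ ⊤ → A ⊔ B = H → Disjoint A B → A ≠ H → IsEmpty (G ≃+ A)

/-- An abelian group is reduced if its only divisible subgroup is the trivial one. -/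
def IsReducedAb (G : Type*) [AddCommGroup G] : Prop :=
  ∀ D : AddSubgroup G, Nonempty (DivisibleBy D ℤ) → D = ⊥

/-- An abelian group `T` (in practice a torsion group) is quotient reduced co-Hopfian if every
injective endomorphism `φ` of `T` such that `T / φ(T)` is reduced is surjective. -/
def IsQuotientReducedCoHopfian (T : Type*) [AddCommGroup T] : Prop :=
  ∀ φ : T →+ T, Function.Injective φ → IsReducedAb (T ⧸ φ.range) → Function.Surjective φ

/-- The group `Ext(A, G) = Ext¹_ℤ(A, G)` of abelian groups. -/
abbrev ExtAb (A G : Type u) [AddCommGroup A] [AddCommGroup G] : Type u :=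
  Abelian.Ext.{u} (ModuleCat.of ℤ A) (ModuleCat.of ℤ G) 1

/-- An abelian group `G` is cotorsion if `Ext(J, G) = 0` for every torsion-free group `J`. -/
def IsCotorsion (G : Type u) [AddCommGroup G] : Prop :=
  ∀ (J : Type u) [AddCommGroup J], IsAddTorsionFree J → Subsingleton (ExtAb J G)

/-- A cotorsion group is adjusted if it is reduced and has no nonzero torsion-free direct
summand. -/
structure IsAdjustedCotorsion (G : Type u) [AddCommGroup G] : Prop where
  cotorsion : IsCotorsion G
  reduced : IsReducedAb G
  eq_bot_of_torsionFree_summand :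
    ∀ A B : AddSubgroup G, IsCompl A B → IsAddTorsionFree A → A = ⊥

/-- The group `ℚ/ℤ`, placed in the universe `u`. -/
abbrev QModZ : Type u := ULift.{u} (ℚ ⧸ (Int.castAddHom ℚ).range)

/-! Everything rests on `G ⧸ torsion G` being divisible. Let U be the preimage of its largest
divisible subgroup. Then G/U is torsion-free and receives no nonzero map from ℚ, and Ext(ℚ, G) = 0
makes U a direct summand (`exists_retraction`). Its complement is torsion-free, hence zero by
adjustedness. The isomorphism with Ext(ℚ/ℤ, T) then follows from two long exact sequences, for ℤ → ℚ
→ ℚ/ℤ and T → G → G/T.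

For injective φ, Ext(ℚ, φ(G)) = 0 makes G/φ(G) reduced. Once T ≤ φ(G), the divisible group G/T maps
onto it, so φ is surjective. Thus only torsion matters. Between (a) and (c), endomorphisms of T
extend to G because Ext(G/T, G) = 0, and injective endomorphisms of G restrict to T.

For (b) → (a), relative co-Hopficity forces φ(G) to meet every nonzero subgroup. If a layer G[p] ∩
pⁿG had infinite index over the next, G would have an infinite homogeneous summand, and a shift on
it would violate this. So all layers have finite index in G[p], φ maps each onto itself by an index
count, and induction on the exponent gives T ≤ φ(G). -/

/-! ### Reduced groups, divisible groups and maps from ℚ. -/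

theorem IsReducedAb.eq_bot {G : Type*} [AddCommGroup G] (hG : IsReducedAb G) (D : AddSubgroup G)
    (h : ∀ n : ℕ, n ≠ 0 → ∀ x ∈ D, ∃ y ∈ D, n • y = x) : D = ⊥ := by
  have : DivisibleBy D ℕ := divisibleByOfSMulRightSurj D ℕ fun {n} hn x => by
    obtain ⟨y, hy, hyx⟩ := h n hn x x.2
    exact ⟨⟨y, hy⟩, Subtype.ext hyx⟩
  exact hG D ⟨AddGroup.divisibleByIntOfDivisibleByNat D⟩

theorem IsReducedAb.hom_eq_zero {G Q : Type*} [AddCommGroup G] [AddCommGroup Q]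
    (hG : IsReducedAb G) (hQ : ∀ n : ℕ, n ≠ 0 → ∀ x : Q, ∃ y, n • y = x) (f : Q →+ G) : f = 0 := by
  have := hG.eq_bot f.range (by
    rintro n hn _ ⟨x, rfl⟩
    obtain ⟨y, rfl⟩ := hQ n hn x
    exact ⟨f y, ⟨y, rfl⟩, (map_nsmul f n y).symm⟩)
  exact f.range_eq_bot_iff.mp this

theorem AddMonoidHom.exists_extension_of_divisible {A B D : Type*} [AddCommGroup A]
    [AddCommGroup B] [AddCommGroup D] (hD : ∀ n : ℕ, n ≠ 0 → ∀ x : D, ∃ y, n • y = x)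
    (i : A →+ B) (hi : Function.Injective i) (f : A →+ D) : ∃ g : B →+ D, g.comp i = f := by
  have : DivisibleBy D ℕ := divisibleByOfSMulRightSurj D ℕ fun {n} hn x => hD n hn x
  have : DivisibleBy D ℤ := AddGroup.divisibleByIntOfDivisibleByNat D
  exact (Module.Baer.of_divisible D).extension_property_addMonoidHom i hi f

theorem ULift.rat_divisible : ∀ n : ℕ, n ≠ 0 → ∀ x : ULift.{u} ℚ, ∃ y, n • y = x := by
  intro n hn x
  refine ⟨⟨x.down / n⟩, ?_⟩
  ext
  simp
  field_simp

/-- The inclusion of the integers into the rationals, in the universe `u`. -/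
def uliftIntToRat : ULift.{u} ℤ →+ ULift.{u} ℚ :=
  AddEquiv.ulift.symm.toAddMonoidHom.comp
    ((Int.castAddHom ℚ).comp AddEquiv.ulift.toAddMonoidHom)

theorem uliftIntToRat_injective : Function.Injective uliftIntToRat.{u} := by
  intro a b h
  have := congrArg ULift.down h
  exact ULift.ext _ _ (Int.cast_injective (α := ℚ) this)

/-- The homomorphism from the integers sending `1` to a given element. -/
def uliftIntHom {G : Type*} [AddCommGroup G] : G →+ (ULift.{u} ℤ →+ G) where
  toFun g := (zmultiplesHom G g).comp AddEquiv.ulift.toAddMonoidHom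
  map_zero' := by ext; simp
  map_add' a b := by ext; simp

theorem uliftIntHom_apply {G : Type*} [AddCommGroup G] (g : G) (n : ULift.{u} ℤ) :
    uliftIntHom g n = n.down • g := rfl

theorem uliftIntHom_bijective {G : Type*} [AddCommGroup G] :
    Function.Bijective (uliftIntHom.{u} (G := G)) := by
  constructor
  · intro a b h
    simpa [uliftIntHom_apply] using DFunLike.congr_fun h ⟨1⟩
  · intro f
    refine ⟨f ⟨1⟩, ?_⟩
    ext n
    rw [uliftIntHom_apply, ← map_zsmul]
    congr 1
    ext
    simp

/-- The map ℤ → D sending 1 to an element of a divisible D extends to ℚ; if the extension vanishes,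
so does the element. -/
theorem isReducedAb_of_hom_rat {G : Type*} [AddCommGroup G]
    (h : ∀ f : ULift.{u} ℚ →+ G, f = 0) : IsReducedAb G := by
  rintro D ⟨hD⟩
  rw [eq_bot_iff]
  intro x hx
  obtain ⟨g, hg⟩ := AddMonoidHom.exists_extension_of_divisible (D := D)
    (fun n hn x => ⟨DivisibleBy.div x (n : ℤ), by
      have := DivisibleBy.div_cancel (α := ℤ) x (Nat.cast_ne_zero.mpr hn : (n : ℤ) ≠ 0)
      simpa using this⟩)
    uliftIntToRat.{u} uliftIntToRat_injective (uliftIntHom ⟨x, hx⟩)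
  have h1 := DFunLike.congr_fun hg ⟨1⟩
  have h2 := DFunLike.congr_fun (h (D.subtype.comp g)) (uliftIntToRat ⟨1⟩)
  simp only [AddMonoidHom.comp_apply] at h1 h2
  rw [h1, uliftIntHom_apply] at h2
  simpa using h2

theorem exists_divisible_embedding (G : Type u) [AddCommGroup G] :
    ∃ (D : Type u) (_ : AddCommGroup D) (i : G →+ D), Function.Injective i ∧
      ∀ n : ℕ, n ≠ 0 → ∀ x : D, ∃ y, n • y = x := by
  refine ⟨CharacterModule G → AddCircle (1 : ℚ), inferInstance,
    { toFun := fun g c => c g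
      map_zero' := by ext c; exact map_zero c
      map_add' := fun a b => by ext c; exact map_add c a b }, ?_, ?_⟩
  · rw [injective_iff_map_eq_zero]
    intro a ha
    exact CharacterModule.eq_zero_of_character_apply fun c => congrFun ha c
  · intro n hn x
    refine ⟨fun c => DivisibleBy.div (x c) (n : ℤ), ?_⟩
    ext c
    have := DivisibleBy.div_cancel (α := ℤ) (x c) (Nat.cast_ne_zero.mpr hn : (n : ℤ) ≠ 0)
    simpa using this

/-! ### Consequences of the long exact Ext sequences. -/

section Ext

open Abelian

variable {A B C : Type u} [AddCommGroup A] [AddCommGroup B] [AddCommGroup C]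

/-- The short complex of `ℤ`-modules attached to an exact pair of homomorphisms. -/
abbrev intShortComplex (i : A →+ B) (p : B →+ C) (h : Function.Exact i p) :
    ShortComplex (ModuleCat.{u} ℤ) :=
  ShortComplex.mk (ModuleCat.ofHom i.toIntLinearMap) (ModuleCat.ofHom p.toIntLinearMap) (by
    ext x
    exact h.apply_apply_eq_zero x)

theorem intShortComplex_shortExact (i : A →+ B) (p : B →+ C) (h : Function.Exact i p)
    (hi : Function.Injective i) (hp : Function.Surjective p) :
    (intShortComplex i p h).ShortExact where
  exact := (ShortComplex.ShortExact.moduleCat_exact_iff_function_exact _).mpr h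
  mono_f := (ModuleCat.mono_iff_injective _).mpr hi
  epi_g := (ModuleCat.epi_iff_surjective _).mpr hp

theorem exists_lift_of_subsingleton_ext {J : Type u} [AddCommGroup J] (i : A →+ B) (p : B →+ C)
    (h : Function.Exact i p) (hi : Function.Injective i) (hp : Function.Surjective p)
    (hJ : Subsingleton (ExtAb J A)) (f : J →+ C) : ∃ g : J →+ B, p.comp g = f := by
  have hS := intShortComplex_shortExact i p h hi hp
  obtain ⟨x, hx⟩ := Ext.covariant_sequence_exact₃ (ModuleCat.of ℤ J) hS
    (Ext.mk₀ (ModuleCat.ofHom f.toIntLinearMap)) (zero_add 1) (Subsingleton.elim _ _)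
  obtain ⟨g, rfl⟩ := Ext.addEquiv₀.symm.surjective x
  refine ⟨g.hom.toAddMonoidHom, ?_⟩
  ext j
  have := (Ext.mk₀_comp_mk₀ _ _).symm.trans hx
  have := Ext.addEquiv₀.symm.injective this
  exact DFunLike.congr_fun (congrArg ModuleCat.Hom.hom this) j

theorem exists_extension_of_subsingleton_ext {G : Type u} [AddCommGroup G] (i : A →+ B)
    (p : B →+ C) (h : Function.Exact i p) (hi : Function.Injective i) (hp : Function.Surjective p)
    (hC : Subsingleton (ExtAb C G)) (f : A →+ G) : ∃ g : B →+ G, g.comp i = f := by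
  have hS := intShortComplex_shortExact i p h hi hp
  obtain ⟨x, hx⟩ := Ext.contravariant_sequence_exact₁ hS (ModuleCat.of ℤ G)
    (Ext.mk₀ (ModuleCat.ofHom f.toIntLinearMap)) (add_zero 1) (Subsingleton.elim _ _)
  obtain ⟨g, rfl⟩ := Ext.addEquiv₀.symm.surjective x
  refine ⟨g.hom.toAddMonoidHom, ?_⟩
  ext j
  have := (Ext.mk₀_comp_mk₀ _ _).symm.trans hx
  have := Ext.addEquiv₀.symm.injective this
  exact DFunLike.congr_fun (congrArg ModuleCat.Hom.hom this) j

theorem subsingleton_ext_of_divisible (J : Type u) [AddCommGroup J]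
    (hA : ∀ n : ℕ, n ≠ 0 → ∀ x : A, ∃ y, n • y = x) : Subsingleton (ExtAb J A) := by
  have : DivisibleBy A ℕ := divisibleByOfSMulRightSurj A ℕ fun {n} hn x => hA n hn x
  have : DivisibleBy A ℤ := AddGroup.divisibleByIntOfDivisibleByNat A
  have : Module.Injective ℤ A := (Module.Baer.of_divisible A).injective
  have : Injective (ModuleCat.of ℤ A) := Module.injective_object_of_injective_module ℤ A
  exact Ext.subsingleton_of_injective _ _ 0

/-- If `Hom(J, C) = 0` and `Ext(J, C) = 0`, then `Ext(J, A) ≅ Ext(J, B)`. -/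
theorem nonempty_ext_addEquiv {J : Type u} [AddCommGroup J] (i : A →+ B) (p : B →+ C)
    (h : Function.Exact i p) (hi : Function.Injective i) (hp : Function.Surjective p)
    (hJ : ∀ f : J →+ C, f = 0) (hC : Subsingleton (ExtAb J C)) :
    Nonempty (ExtAb J A ≃+ ExtAb J B) := by
  have hS := intShortComplex_shortExact i p h hi hp
  refine ⟨AddEquiv.ofBijective
    ((Ext.mk₀ (intShortComplex i p h).f).postcomp (ModuleCat.of ℤ J) (add_zero 1)) ⟨?_, ?_⟩⟩
  · rw [injective_iff_map_eq_zero]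
    intro x hx
    obtain ⟨y, rfl⟩ := Ext.covariant_sequence_exact₁ (ModuleCat.of ℤ J) hS x hx (zero_add 1)
    obtain ⟨g, rfl⟩ := Ext.addEquiv₀.symm.surjective y
    have hg : g = 0 := by
      ext j
      exact DFunLike.congr_fun (hJ g.hom.toAddMonoidHom) j
    simp [hg]
  · intro x
    exact Ext.covariant_sequence_exact₂ (ModuleCat.of ℤ J) hS x (Subsingleton.elim _ _)

/-- If `Hom(B, G) = 0` and `Ext(B, G) = 0`, then `Hom(A, G) ≅ Ext(C, G)`. -/
theorem nonempty_hom_addEquiv_ext {G : Type u} [AddCommGroup G] (i : A →+ B) (p : B →+ C)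
    (h : Function.Exact i p) (hi : Function.Injective i) (hp : Function.Surjective p)
    (hB : ∀ f : B →+ G, f = 0) (hE : Subsingleton (ExtAb B G)) :
    Nonempty ((A →+ G) ≃+ ExtAb C G) := by
  have hS := intShortComplex_shortExact i p h hi hp
  let e : (A →+ G) ≃+ Ext (ModuleCat.of ℤ A) (ModuleCat.of ℤ G) 0 :=
    ((addMonoidHomLequivInt ℤ).toAddEquiv.trans
      (ModuleCat.homAddEquiv (M := ModuleCat.of ℤ A) (N := ModuleCat.of ℤ G)).symm).trans
      Ext.addEquiv₀.symm
  refine ⟨e.trans (AddEquiv.ofBijective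
    (hS.extClass.precomp (ModuleCat.of ℤ G) (add_zero 1)) ⟨?_, ?_⟩)⟩
  · rw [injective_iff_map_eq_zero]
    intro x hx
    obtain ⟨y, rfl⟩ := Ext.contravariant_sequence_exact₁ hS (ModuleCat.of ℤ G) x (add_zero 1) hx
    obtain ⟨g, rfl⟩ := Ext.addEquiv₀.symm.surjective y
    have hg : g = 0 := by
      ext j
      exact DFunLike.congr_fun (hB g.hom.toAddMonoidHom) j
    simp [hg]
  · intro x
    exact Ext.contravariant_sequence_exact₃ hS (ModuleCat.of ℤ G) x (Subsingleton.elim _ _)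
      (add_zero 1)

end Ext

/-! ### Splitting off a subgroup when Ext(ℚ, G) = 0. -/

section Splitting

variable {G : Type u} [AddCommGroup G]

/-- If `Ext(ℚ, G) = 0 = Hom(ℚ, G/U)`, then every map from `ℚ` lifts along `D → D/U`, where `D` is
divisible and contains `G`. -/
theorem exists_lift_rat_quotient_map {D : Type u} [AddCommGroup D] (i : G →+ D)
    (hi : Function.Injective i) (U : AddSubgroup G)
    (hU : ∀ f : ULift.{u} ℚ →+ G ⧸ U, f = 0) (hE : Subsingleton (ExtAb (ULift.{u} ℚ) G))
    (f : ULift.{u} ℚ →+ D ⧸ U.map i) :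
    ∃ g : ULift.{u} ℚ →+ D, (QuotientAddGroup.mk' (U.map i)).comp g = f := by
  have hle : U.map i ≤ i.range := by
    rintro _ ⟨x, -, rfl⟩
    exact ⟨x, rfl⟩
  let q : D ⧸ U.map i →+ D ⧸ i.range :=
    QuotientAddGroup.map _ _ (AddMonoidHom.id D) hle
  -- Lift modulo all of G first; the error `d` then lands in G/U, where maps from ℚ vanish.
  obtain ⟨g, hg⟩ := exists_lift_of_subsingleton_ext i (QuotientAddGroup.mk' i.range)
    (by intro y; simp) hi (QuotientAddGroup.mk'_surjective _) hE (q.comp f)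
  let j : G ⧸ U →+ D ⧸ U.map i := QuotientAddGroup.map U (U.map i) i (AddSubgroup.le_comap_map i U)
  have hj : Function.Injective j := by
    rw [injective_iff_map_eq_zero]
    intro x hx
    obtain ⟨x, rfl⟩ := QuotientAddGroup.mk'_surjective U x
    obtain ⟨y, hy, hyx⟩ := (QuotientAddGroup.eq_zero_iff (i x)).mp hx
    exact (QuotientAddGroup.eq_zero_iff x).mpr (hi hyx ▸ hy)
  let d : ULift.{u} ℚ →+ D ⧸ U.map i := f - (QuotientAddGroup.mk' (U.map i)).comp g
  have hd : ∀ x, d x ∈ j.range := by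
    intro x
    obtain ⟨y, hy⟩ := QuotientAddGroup.mk'_surjective (U.map i) (d x)
    have : q (d x) = 0 := by
      have := DFunLike.congr_fun hg x
      simp only [d, AddMonoidHom.sub_apply, map_sub]
      rw [sub_eq_zero]
      exact this.symm
    rw [← hy] at this
    obtain ⟨z, rfl⟩ := (QuotientAddGroup.eq_zero_iff y).mp this
    exact ⟨z, hy⟩
  have h0 := hU ((AddMonoidHom.ofInjective hj).symm.toAddMonoidHom.comp (d.codRestrict j.range hd))
  refine ⟨g, ?_⟩
  ext x
  have h1 := DFunLike.congr_fun h0 x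
  have h2 : d.codRestrict j.range hd x = 0 :=
    (AddMonoidHom.ofInjective hj).symm.map_eq_zero_iff.mp h1
  have h3 : d x = 0 := congrArg Subtype.val h2
  exact (sub_eq_zero.mp h3).symm

theorem exists_lift_of_module_rat {D E V : Type*} [AddCommGroup D] [AddCommGroup E]
    [AddCommGroup V] [Module ℚ V] (p : D →+ E)
    (hp : ∀ f : ULift.{u} ℚ →+ E, ∃ g : ULift.{u} ℚ →+ D, p.comp g = f) (f : V →+ E) :
    ∃ g : V →+ D, p.comp g = f := by
  classical
  let b := Module.Basis.ofVectorSpace ℚ V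
  choose g hg using fun k => hp
    ((f.comp (LinearMap.toSpanSingleton ℚ V (b k)).toAddMonoidHom).comp
      AddEquiv.ulift.toAddMonoidHom)
  refine ⟨(Finsupp.liftAddHom fun k => (g k).comp AddEquiv.ulift.symm.toAddMonoidHom).comp
    b.repr.toAddEquiv.toAddMonoidHom, ?_⟩
  have : (p.comp (Finsupp.liftAddHom fun k => (g k).comp AddEquiv.ulift.symm.toAddMonoidHom)) =
      f.comp b.repr.symm.toAddEquiv.toAddMonoidHom := by
    refine Finsupp.addHom_ext fun k y => ?_
    have h1 := DFunLike.congr_fun (hg k) ⟨y⟩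
    simp at h1 ⊢
    exact h1
  ext v
  have h2 := DFunLike.congr_fun this (b.repr v)
  simp at h2 ⊢
  exact h2

/-- With D divisible around G, the map G/U → D/U extends to the divisible hull of G/U, a rational
vector space, and lifts from there to D. Subtracting the lift from G → D pushes G into U and fixes
U. -/
theorem exists_retraction (U : AddSubgroup G) (hT : IsAddTorsionFree (G ⧸ U))
    (hU : ∀ f : ULift.{u} ℚ →+ G ⧸ U, f = 0) (hE : Subsingleton (ExtAb (ULift.{u} ℚ) G)) :
    ∃ r : G →+ U, ∀ x : U, r x = x := by
  obtain ⟨D, _, i, hi, hD⟩ := exists_divisible_embedding G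
  obtain ⟨j, hj⟩ := AddMonoidHom.exists_extension_of_divisible hD U.subtype
    U.subtype_injective (i.comp U.subtype)
  let p := QuotientAddGroup.mk' (U.map i)
  have hdiv : ∀ n : ℕ, n ≠ 0 → ∀ x : D ⧸ U.map i, ∃ y, n • y = x := by
    intro n hn x
    obtain ⟨x, rfl⟩ := QuotientAddGroup.mk'_surjective _ x
    obtain ⟨y, rfl⟩ := hD n hn x
    exact ⟨p y, (map_nsmul p n y).symm⟩
  -- the map `G/U → D/U` induced by `i`
  let f : G ⧸ U →+ D ⧸ U.map i := QuotientAddGroup.map U (U.map i) i (AddSubgroup.le_comap_map i U)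
  obtain ⟨F, hF⟩ := AddMonoidHom.exists_extension_of_divisible hdiv
    (DivisibleHull.coeAddMonoidHom (G ⧸ U)) DivisibleHull.coe_injective f
  obtain ⟨H, hH⟩ := exists_lift_of_module_rat p (exists_lift_rat_quotient_map i hi U hU hE) F
  let e : G →+ D := i - (H.comp (DivisibleHull.coeAddMonoidHom (G ⧸ U))).comp (QuotientAddGroup.mk' U)
  have he : ∀ x, e x ∈ U.map i := by
    intro x
    rw [← QuotientAddGroup.eq_zero_iff]
    change p (i x - H _) = 0
    rw [map_sub, sub_eq_zero]
    have h1 := DFunLike.congr_fun hH (DivisibleHull.coeAddMonoidHom (G ⧸ U) (QuotientAddGroup.mk' U x))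
    have h2 := DFunLike.congr_fun hF (QuotientAddGroup.mk' U x)
    exact (h1.trans h2).symm
  let eU := U.equivMapOfInjective i hi
  refine ⟨eU.symm.toAddMonoidHom.comp (e.codRestrict _ he), fun x => ?_⟩
  have : e.codRestrict _ he x = eU x := by
    ext
    have h0 : QuotientAddGroup.mk' U (x : G) = 0 := (QuotientAddGroup.eq_zero_iff _).mpr x.2
    change i x - H (DivisibleHull.coeAddMonoidHom (G ⧸ U) (QuotientAddGroup.mk' U (x : G))) = i x
    rw [h0, map_zero, map_zero, sub_zero]
  change eU.symm (e.codRestrict _ he x) = x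
  rw [this, AddEquiv.symm_apply_apply]

end Splitting

/-! ### Divisibility of G/T and the isomorphism with Ext(ℚ/ℤ, T). -/

section Torsion

variable {G : Type u} [AddCommGroup G]

open AddCommGroup

theorem mem_torsion_of_nsmul_mem {n : ℕ} (hn : n ≠ 0) {x : G} (h : n • x ∈ torsion G) :
    x ∈ torsion G := by
  obtain ⟨m, hm, hmx⟩ := (isOfFinAddOrder_iff_nsmul_eq_zero).mp h
  exact (isOfFinAddOrder_iff_nsmul_eq_zero).mpr ⟨m * n, Nat.mul_pos hm (Nat.pos_of_ne_zero hn), by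
    rw [mul_nsmul', hmx]⟩

theorem isAddTorsionFree_of_nsmul {M : Type*} [AddCommGroup M]
    (h : ∀ n : ℕ, n ≠ 0 → ∀ x : M, n • x = 0 → x = 0) : IsAddTorsionFree M where
  nsmul_right_injective n hn x y hxy := by
    refine sub_eq_zero.mp (h n hn _ ?_)
    rw [nsmul_sub, sub_eq_zero]
    exact hxy

theorem isAddTorsionFree_quotient {M : Type*} [AddCommGroup M] (U : AddSubgroup M)
    (h : ∀ n : ℕ, n ≠ 0 → ∀ x : M, n • x ∈ U → x ∈ U) : IsAddTorsionFree (M ⧸ U) := by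
  refine isAddTorsionFree_of_nsmul fun n hn x hx => ?_
  obtain ⟨x, rfl⟩ := QuotientAddGroup.mk'_surjective U x
  rw [← map_nsmul] at hx
  exact (QuotientAddGroup.eq_zero_iff _).mpr (h n hn x ((QuotientAddGroup.eq_zero_iff _).mp hx))

theorem isAddTorsionFree_quotient_torsion : IsAddTorsionFree (G ⧸ torsion G) :=
  isAddTorsionFree_quotient _ fun _ hn _ => mem_torsion_of_nsmul_mem hn

variable (G) in
/-- The preimage in `G` of the largest divisible subgroup of `G` modulo torsion. -/
def divisibleModTorsion : AddSubgroup G where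
  carrier := {g | ∀ n : ℕ, n ≠ 0 → ∃ h, g - n • h ∈ torsion G}
  zero_mem' n _ := ⟨0, by simp [zero_mem]⟩
  add_mem' {a b} ha hb n hn := by
    obtain ⟨h, hh⟩ := ha n hn
    obtain ⟨k, hk⟩ := hb n hn
    refine ⟨h + k, ?_⟩
    have := add_mem hh hk
    rwa [show a - n • h + (b - n • k) = a + b - n • (h + k) by rw [nsmul_add]; abel] at this
  neg_mem' {a} ha n hn := by
    obtain ⟨h, hh⟩ := ha n hn
    refine ⟨-h, ?_⟩
    have := neg_mem hh
    rwa [show -(a - n • h) = -a - n • (-h) by rw [smul_neg]; abel] at this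

theorem torsion_le_divisibleModTorsion : torsion G ≤ divisibleModTorsion G :=
  fun x hx n _ => ⟨0, by simpa using hx⟩

theorem mem_divisibleModTorsion_of_nsmul_mem {n : ℕ} (hn : n ≠ 0) {x : G}
    (h : n • x ∈ divisibleModTorsion G) : x ∈ divisibleModTorsion G := by
  intro m hm
  obtain ⟨y, hy⟩ := h (n * m) (mul_ne_zero hn hm)
  refine ⟨y, mem_torsion_of_nsmul_mem hn ?_⟩
  rwa [nsmul_sub, ← mul_nsmul']

theorem exists_mem_divisibleModTorsion {n : ℕ} (hn : n ≠ 0) {x : G}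
    (hx : x ∈ divisibleModTorsion G) : ∃ y ∈ divisibleModTorsion G, x - n • y ∈ torsion G := by
  obtain ⟨y, hy⟩ := hx n hn
  refine ⟨y, mem_divisibleModTorsion_of_nsmul_mem hn ?_, hy⟩
  have := sub_mem hx (torsion_le_divisibleModTorsion hy)
  rwa [sub_sub_cancel] at this

theorem hom_rat_quotient_divisibleModTorsion (f : ULift.{u} ℚ →+ G ⧸ divisibleModTorsion G) :
    f = 0 := by
  ext q
  obtain ⟨g, hg⟩ := QuotientAddGroup.mk'_surjective _ (f q)
  have : g ∈ divisibleModTorsion G := by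
    intro n hn
    obtain ⟨q', rfl⟩ := ULift.rat_divisible n hn q
    obtain ⟨h, hh⟩ := QuotientAddGroup.mk'_surjective _ (f q')
    rw [map_nsmul, ← hh, ← map_nsmul] at hg
    have hm : g - n • h ∈ divisibleModTorsion G := by
      rw [← QuotientAddGroup.eq_zero_iff]
      exact (map_sub (QuotientAddGroup.mk' _) g (n • h)).trans (sub_eq_zero.mpr hg)
    obtain ⟨y, -, hy⟩ := exists_mem_divisibleModTorsion hn hm
    -- `f` only gives divisibility of `g` modulo U; the error lies in U, hence is itself divisible
    -- modulo torsion.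
    exact ⟨h + y, by rwa [nsmul_add, ← sub_sub]⟩
  rw [← hg]
  exact (QuotientAddGroup.eq_zero_iff g).mpr this

theorem subsingleton_ext_rat (hG : IsCotorsion G) : Subsingleton (ExtAb (ULift.{u} ℚ) G) :=
  hG _ (isAddTorsionFree_of_nsmul fun n hn x hx => by
    have := congrArg ULift.down hx
    ext
    simpa [hn] using this)

theorem isReducedAb_quotient_range (hc : IsCotorsion G) (hr : IsReducedAb G) (φ : G →+ G)
    (hφ : Function.Injective φ) : IsReducedAb (G ⧸ φ.range) := by
  refine isReducedAb_of_hom_rat.{u} fun f => ?_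
  obtain ⟨g, rfl⟩ := exists_lift_of_subsingleton_ext φ (QuotientAddGroup.mk' φ.range)
    (by intro y; simp) hφ (QuotientAddGroup.mk'_surjective _) (subsingleton_ext_rat hc) f
  rw [hr.hom_eq_zero ULift.rat_divisible g, AddMonoidHom.comp_zero]

/-- An adjusted cotorsion group is divisible modulo its torsion subgroup. -/
theorem IsAdjustedCotorsion.divisible_quotient_torsion (hG : IsAdjustedCotorsion G) :
    ∀ n : ℕ, n ≠ 0 → ∀ x : G ⧸ torsion G, ∃ y, n • y = x := by
  have htf := isAddTorsionFree_quotient (divisibleModTorsion G) fun n hn x hx =>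
    mem_divisibleModTorsion_of_nsmul_mem hn hx
  obtain ⟨r, hr⟩ := exists_retraction (divisibleModTorsion G) htf
    hom_rat_quotient_divisibleModTorsion (subsingleton_ext_rat hG.cotorsion)
  have hker : r.ker = ⊥ := by
    refine hG.eq_bot_of_torsionFree_summand r.ker (divisibleModTorsion G) ⟨?_, ?_⟩ ?_
    · rw [AddSubgroup.disjoint_def]
      intro x hx hxU
      have h1 : r x = ⟨x, hxU⟩ := hr ⟨x, hxU⟩
      rw [AddMonoidHom.mem_ker.mp hx] at h1
      exact (congrArg Subtype.val h1).symm
    · rw [codisjoint_iff_le_sup]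
      intro x _
      rw [AddSubgroup.mem_sup]
      refine ⟨x - r x, ?_, r x, (r x).2, sub_add_cancel _ _⟩
      rw [AddMonoidHom.mem_ker, map_sub, hr, sub_self]
    -- U contains all torsion and `r` fixes U, so its kernel has none.
    · refine isAddTorsionFree_of_nsmul fun n hn x hx => ?_
      have hxU : (x : G) ∈ divisibleModTorsion G :=
        mem_divisibleModTorsion_of_nsmul_mem hn (by
          have := congrArg Subtype.val hx
          rw [AddSubgroup.coe_nsmul] at this
          rw [this]
          exact zero_mem _)
      have h1 : r x = ⟨x, hxU⟩ := hr ⟨x, hxU⟩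
      rw [AddMonoidHom.mem_ker.mp x.2] at h1
      exact Subtype.ext (congrArg Subtype.val h1).symm
  have hinj : Function.Injective r := r.ker_eq_bot_iff.mp hker
  intro n hn x
  obtain ⟨x, rfl⟩ := QuotientAddGroup.mk'_surjective _ x
  have hx : x ∈ divisibleModTorsion G := by
    have : r (r x) = r x := hr (r x)
    exact hinj this ▸ (r x).2
  obtain ⟨y, hy⟩ := hx n hn
  refine ⟨QuotientAddGroup.mk' _ y, ?_⟩
  rw [← map_nsmul, eq_comm, ← sub_eq_zero, ← map_sub]
  exact (QuotientAddGroup.eq_zero_iff _).mpr hy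

/-- An adjusted cotorsion group `G` with torsion subgroup `T` is isomorphic to `Ext(ℚ/ℤ, T)`. -/
theorem IsAdjustedCotorsion.nonempty_addEquiv_ext (hG : IsAdjustedCotorsion G) :
    Nonempty (G ≃+ ExtAb QModZ.{u} (torsion G)) := by
  let p : ULift.{u} ℚ →+ QModZ.{u} := AddEquiv.ulift.symm.toAddMonoidHom.comp
    ((QuotientAddGroup.mk' _).comp AddEquiv.ulift.toAddMonoidHom)
  have hp : Function.Surjective p := by
    rintro ⟨x⟩
    obtain ⟨x, rfl⟩ := QuotientAddGroup.mk'_surjective _ x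
    exact ⟨⟨x⟩, rfl⟩
  have hex : Function.Exact uliftIntToRat.{u} p := by
    rintro ⟨x⟩
    constructor
    · intro h
      obtain ⟨n, hn⟩ := (QuotientAddGroup.eq_zero_iff x).mp (congrArg ULift.down h)
      exact ⟨⟨n⟩, ULift.ext _ _ hn⟩
    · rintro ⟨⟨n⟩, hn⟩
      exact ULift.ext _ _ ((QuotientAddGroup.eq_zero_iff x).mpr ⟨n, congrArg ULift.down hn⟩)
  obtain ⟨e₁⟩ := nonempty_hom_addEquiv_ext (G := G) uliftIntToRat.{u} p hex
    uliftIntToRat_injective hp (hG.reduced.hom_eq_zero ULift.rat_divisible)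
    (subsingleton_ext_rat hG.cotorsion)
  have htf := isAddTorsionFree_quotient_torsion (G := G)
  obtain ⟨e₂⟩ := nonempty_ext_addEquiv (J := QModZ.{u}) (torsion G).subtype
    (QuotientAddGroup.mk' (torsion G)) (by intro y; simp)
    (torsion G).subtype_injective (QuotientAddGroup.mk'_surjective _) (fun f => by
      ext x
      obtain ⟨⟨x⟩, rfl⟩ := hp x
      have hx : x.den • p ⟨x⟩ = 0 := by
        rw [← map_nsmul]
        refine (hex _).mpr ⟨⟨x.num⟩, ULift.ext _ _ ?_⟩
        change (x.num : ℚ) = x.den • x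
        rw [nsmul_eq_mul, mul_comm, Rat.mul_den_eq_num]
      have := congrArg f hx
      rw [map_nsmul, map_zero] at this
      exact (nsmul_eq_zero_iff_right x.den_nz).mp this)
    (subsingleton_ext_of_divisible _ hG.divisible_quotient_torsion)
  exact ⟨((AddEquiv.ofBijective uliftIntHom.{u} uliftIntHom_bijective).trans e₁).trans e₂.symm⟩

end Torsion

/-! ### Infinite homogeneous summands, shifts and socle layers. -/

/-- An ideal is generated by a divisor d of n, and the image of d is killed by n/d, hence divisible
by d in each coordinate. -/
theorem ZMod.baer_finsupp (n : ℕ) [NeZero n] (ι : Type*) :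
    Module.Baer (ZMod n) (ι →₀ ZMod n) := by
  classical
  intro I g
  obtain ⟨d, hd⟩ := (IsPrincipalIdealRing.principal (I.comap (Int.castRingHom (ZMod n)))).principal
  have hmem : ∀ z : ℤ, (z : ZMod n) ∈ I ↔ d ∣ z := fun z => by
    rw [← Ideal.mem_span_singleton]
    change z ∈ I.comap (Int.castRingHom (ZMod n)) ↔ _
    rw [hd]
  obtain ⟨e, he⟩ : d ∣ (n : ℤ) := (hmem n).mp (by simp)
  have hdI : (d : ZMod n) ∈ I := (hmem d).mpr dvd_rfl
  have he0 : e ≠ 0 := by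
    rintro rfl
    exact NeZero.ne n (by simpa using he)
  have hm : (e : ZMod n) • g ⟨d, hdI⟩ = 0 := by
    rw [← map_smul]
    have : (e : ZMod n) • (⟨d, hdI⟩ : I) = 0 := by
      ext
      have := congrArg (Int.cast : ℤ → ZMod n) he
      push_cast at this
      simpa [mul_comm] using this.symm
    rw [this, map_zero]
  have hdiv : ∀ k, ∃ w : ZMod n, g ⟨d, hdI⟩ k = d * w := by
    intro k
    have hk := DFunLike.congr_fun hm k
    obtain ⟨z, hz⟩ := ZMod.intCast_surjective (g ⟨d, hdI⟩ k)
    rw [Finsupp.smul_apply, ← hz, smul_eq_mul, ← Int.cast_mul, Finsupp.zero_apply,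
      ZMod.intCast_zmod_eq_zero_iff_dvd, he, mul_comm d e] at hk
    obtain ⟨w, rfl⟩ := (mul_dvd_mul_iff_left he0).mp hk
    exact ⟨w, by rw [← hz, Int.cast_mul]⟩
  choose w hw using hdiv
  -- A quotient of 0 by d need not be 0, so 0 is imposed there to keep the support finite.
  let m : ι →₀ ZMod n := Finsupp.onFinset (g ⟨d, hdI⟩).support
    (fun k => if g ⟨d, hdI⟩ k = 0 then 0 else w k) (by intro k; simp +contextual)
  have hdm : (d : ZMod n) • m = g ⟨d, hdI⟩ := by
    ext k
    by_cases hk : g ⟨d, hdI⟩ k = 0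
    · simp [m, hk]
    · simp [m, hk, ← hw]
  refine ⟨LinearMap.toSpanSingleton (ZMod n) _ m, fun x hx => ?_⟩
  obtain ⟨z, rfl⟩ := ZMod.intCast_surjective x
  obtain ⟨c, rfl⟩ := (hmem z).mp hx
  rw [LinearMap.toSpanSingleton_apply]
  have : (⟨((d * c : ℤ) : ZMod n), hx⟩ : I) = (c : ZMod n) • ⟨d, hdI⟩ := by
    ext
    simp [mul_comm]
  rw [this, map_smul, ← hdm, smul_smul, Int.cast_mul, mul_comm]

section Shift

variable {G : Type*} [AddCommGroup G]

/-- A pure bounded homogeneous subgroup is a direct summand. -/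
theorem exists_retraction_finsupp_zmod {n : ℕ} [NeZero n] {κ : Type*} (i : (κ →₀ ZMod n) →+ G)
    (h : ∀ x, i x ∈ (nsmulAddMonoidHom (α := G) n).range → x = 0) :
    ∃ r : G →+ (κ →₀ ZMod n), ∀ x, r (i x) = x := by
  let W := G ⧸ (nsmulAddMonoidHom (α := G) n).range
  let : Module (ZMod n) W := AddCommGroup.zmodModule fun x => by
    obtain ⟨x, rfl⟩ := QuotientAddGroup.mk'_surjective _ x
    rw [← map_nsmul]
    exact (QuotientAddGroup.eq_zero_iff _).mpr ⟨x, rfl⟩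
  let j : (κ →₀ ZMod n) →+ W := (QuotientAddGroup.mk' _).comp i
  have hj : Function.Injective j := by
    rw [injective_iff_map_eq_zero]
    exact fun x hx => h x ((QuotientAddGroup.eq_zero_iff _).mp hx)
  obtain ⟨r, hr⟩ := (ZMod.baer_finsupp n κ).extension_property (j.toZModLinearMap n) hj
    LinearMap.id
  exact ⟨r.toAddMonoidHom.comp (QuotientAddGroup.mk' _), fun x => DFunLike.congr_fun hr x⟩

/-- The shift on an infinite homogeneous direct summand. -/
theorem exists_injective_disjoint_range {n : ℕ} (hn : n ≠ 1) (i : (ℕ →₀ ZMod n) →+ G)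
    (r : G →+ (ℕ →₀ ZMod n)) (hr : ∀ x, r (i x) = x) :
    ∃ φ : G →+ G, Function.Injective φ ∧ ∃ B : AddSubgroup G, B ≠ ⊥ ∧ Disjoint φ.range B := by
  have : Nontrivial (ZMod n) := ZMod.nontrivial_iff.mpr hn
  let s : (ℕ →₀ ZMod n) →+ (ℕ →₀ ZMod n) := Finsupp.mapDomain.addMonoidHom Nat.succ
  have hs : Function.Injective s := Finsupp.mapDomain_injective Nat.succ_injective
  have hs0 : ∀ x, s x 0 = 0 := fun x => Finsupp.mapDomain_of_notMem_range x 0 (by simp)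
  -- Identity on the kernel of `r`, shift on the image of `i`; the range misses coordinate 0.
  let φ : G →+ G := AddMonoidHom.id G - i.comp r + i.comp (s.comp r)
  have hrφ : ∀ g, r (φ g) = s (r g) := fun g => by simp [φ, hr]
  refine ⟨φ, ?_, AddSubgroup.zmultiples (i (Finsupp.single 0 1)), ?_, ?_⟩
  · rw [injective_iff_map_eq_zero]
    intro g hg
    have h1 := hrφ g
    rw [hg, map_zero, eq_comm, map_eq_zero_iff s hs] at h1
    simpa [φ, h1] using hg
  · rw [Ne, AddSubgroup.zmultiples_eq_bot]
    intro h
    have := hr (Finsupp.single 0 1)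
    rw [h, map_zero] at this
    exact one_ne_zero (Finsupp.single_eq_zero.mp this.symm)
  · rw [AddSubgroup.disjoint_def]
    rintro _ ⟨g, rfl⟩ hg
    obtain ⟨m, hm⟩ := AddSubgroup.mem_zmultiples_iff.mp hg
    have h1 := hrφ g
    rw [← hm, map_zsmul, hr] at h1
    have h2 := DFunLike.congr_fun h1 0
    rw [hs0] at h2
    rw [← hm, ← map_zsmul, Finsupp.smul_single]
    rw [Finsupp.smul_single, Finsupp.single_eq_same] at h2
    rw [h2, Finsupp.single_zero, map_zero]

variable (G) in
/-- The elements of order dividing `p` and of height at least `n`. -/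
def socleLayer (p n : ℕ) : AddSubgroup G :=
  (nsmulAddMonoidHom (α := G) p).ker ⊓ (nsmulAddMonoidHom (α := G) (p ^ n)).range

theorem mem_socleLayer {p n : ℕ} {x : G} :
    x ∈ socleLayer G p n ↔ p • x = 0 ∧ ∃ y, p ^ n • y = x := Iff.rfl

theorem socleLayer_succ_le (p n : ℕ) : socleLayer G p (n + 1) ≤ socleLayer G p n := by
  rintro x ⟨hx, y, rfl⟩
  exact ⟨hx, p • y, by simp [pow_succ, mul_nsmul']⟩

theorem exists_linearIndependent_nat (K V : Type*) [Field K] [Finite K] [AddCommGroup V]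
    [Module K V] [Infinite V] : ∃ v : ℕ → V, LinearIndependent K v := by
  let b := Module.Basis.ofVectorSpace K V
  have : Infinite (Module.Basis.ofVectorSpaceIndex K V) := by
    rw [← not_finite_iff_infinite]
    intro hfin
    have hf : Module.Finite K V := Module.Finite.of_basis b
    have hV : Finite V := Module.finite_of_finite K
    exact not_finite V
  let e := Infinite.natEmbedding (Module.Basis.ofVectorSpaceIndex K V)
  exact ⟨b ∘ e, b.linearIndependent.comp e e.injective⟩

theorem exists_nsmul_of_linearIndependent {p : ℕ} {S V : Type*} [AddCommGroup S] [AddCommGroup V]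
    [Module (ZMod p) V] (q : S →+ V) (x : ℕ → S) (hx : LinearIndependent (ZMod p) fun k => q (x k))
    (u : ℕ →₀ ℤ) (hu : q (Finsupp.liftAddHom (fun k => zmultiplesHom S (x k)) u) = 0) :
    ∃ v : ℕ →₀ ℤ, u = p • v := by
  have : q.comp (Finsupp.liftAddHom (fun k => zmultiplesHom S (x k))) =
      (Finsupp.linearCombination (ZMod p) fun k => q (x k)).toAddMonoidHom.comp
        (Finsupp.mapRange.addMonoidHom (Int.castAddHom (ZMod p))) := by
    refine Finsupp.addHom_ext fun k a => ?_
    simp [Int.cast_smul_eq_zsmul]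
  have h2 := linearIndependent_iff.mp hx _ ((DFunLike.congr_fun this u).symm.trans hu)
  refine ⟨u.mapRange (fun a => a / p) (by simp), ?_⟩
  ext k
  have h3 : (u k : ZMod p) = 0 := DFunLike.congr_fun h2 k
  rw [ZMod.intCast_zmod_eq_zero_iff_dvd] at h3
  simp [Int.mul_ediv_cancel' h3]

/-- Index 0 means infinite index. Integer coefficients let the same combination be formed later with
elements of higher order. -/
theorem exists_independent_sequence {p : ℕ} [Fact p.Prime] {S : Type*} [AddCommGroup S]
    (hS : ∀ x : S, p • x = 0) (L : AddSubgroup S) (hL : L.index = 0) :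
    ∃ x : ℕ → S, ∀ u : ℕ →₀ ℤ, Finsupp.liftAddHom (fun k => zmultiplesHom S (x k)) u ∈ L →
      ∃ v : ℕ →₀ ℤ, u = p • v := by
  have hV : Infinite (S ⧸ L) := AddSubgroup.index_eq_zero_iff_infinite.mp hL
  let : Module (ZMod p) (S ⧸ L) := AddCommGroup.zmodModule fun x => by
    obtain ⟨x, rfl⟩ := QuotientAddGroup.mk'_surjective _ x
    rw [← map_nsmul, hS, map_zero]
  obtain ⟨v, hli⟩ := exists_linearIndependent_nat (ZMod p) (S ⧸ L)
  choose x hx using fun k => QuotientAddGroup.mk'_surjective L (v k)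
  obtain rfl : (fun k => QuotientAddGroup.mk' L (x k)) = v := funext hx
  exact ⟨x, fun u hu => exists_nsmul_of_linearIndependent _ x hli u
    ((QuotientAddGroup.eq_zero_iff _).mpr hu)⟩

/-- Write elements independent modulo the next layer as pⁿy; the y generate copies of ℤ/pⁿ⁺¹ that
remain independent modulo pⁿ⁺¹G. -/
theorem exists_finsupp_zmod_hom {p n : ℕ} [Fact p.Prime]
    (h : (socleLayer G p (n + 1)).relIndex (socleLayer G p n) = 0) :
    ∃ i : (ℕ →₀ ZMod (p ^ (n + 1))) →+ G,
      ∀ x, i x ∈ (nsmulAddMonoidHom (α := G) (p ^ (n + 1))).range → x = 0 := by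
  let L := (socleLayer G p (n + 1)).addSubgroupOf (socleLayer G p n)
  obtain ⟨x, hx⟩ := exists_independent_sequence (fun x => Subtype.ext x.2.1) L h
  choose y hy using fun k => (x k).2.2
  let ξ : (ℕ →₀ ℤ) →+ socleLayer G p n := Finsupp.liftAddHom fun k => zmultiplesHom _ (x k)
  let η : (ℕ →₀ ℤ) →+ G := Finsupp.liftAddHom fun k => zmultiplesHom _ (y k)
  have hξη : ∀ u, (ξ u : G) = p ^ n • η u := by
    intro u
    have : (socleLayer G p n).subtype.comp ξ = (nsmulAddMonoidHom (p ^ n)).comp η := by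
      refine Finsupp.addHom_ext fun k a => ?_
      have := hy k
      change p ^ n • y k = (x k : G) at this
      simp only [AddMonoidHom.comp_apply, ξ, η, Finsupp.liftAddHom_apply_single,
        zmultiplesHom_apply, map_zsmul, nsmulAddMonoidHom_apply, this]
      rfl
    exact DFunLike.congr_fun this u
  have hdvd : ∀ u : ℕ →₀ ℤ, p ^ n • η u ∈ (nsmulAddMonoidHom (α := G) (p ^ (n + 1))).range →
      ∃ v : ℕ →₀ ℤ, u = p • v := fun u hu =>
    hx u ((AddSubgroup.mem_addSubgroupOf).mpr ⟨(ξ u).2.1, by rwa [hξη]⟩)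
  have hpow : ∀ u : ℕ →₀ ℤ, η u ∈ (nsmulAddMonoidHom (α := G) (p ^ (n + 1))).range →
      ∀ j ≤ n + 1, ∃ v : ℕ →₀ ℤ, u = p ^ j • v := by
    intro u hu j
    induction j with
    | zero => exact fun _ => ⟨u, by simp⟩
    | succ j ih =>
      intro hj
      obtain ⟨v, rfl⟩ := ih (by omega)
      -- Multiplying by pⁿ⁻ʲ turns pʲη(v) into pⁿη(v), which extracts one more factor p from v.
      obtain ⟨w, rfl⟩ := hdvd v (by
        have := AddSubgroup.nsmul_mem _ hu (p ^ (n - j))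
        rwa [map_nsmul, smul_smul, ← pow_add, Nat.sub_add_cancel (by omega)] at this)
      exact ⟨w, by rw [smul_smul, pow_succ]⟩
  let i : (ℕ →₀ ZMod (p ^ (n + 1))) →+ G := Finsupp.liftAddHom fun k =>
    ZMod.lift (p ^ (n + 1)) ⟨zmultiplesHom G (y k), by
      have h1 := hy k
      have h2 : p • (x k : G) = 0 := (x k).2.1
      change p ^ n • y k = (x k : G) at h1
      rw [← h1, smul_smul, ← pow_succ'] at h2
      rw [zmultiplesHom_apply, natCast_zsmul, h2]⟩
  let ρ : (ℕ →₀ ℤ) →+ (ℕ →₀ ZMod (p ^ (n + 1))) :=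
    Finsupp.mapRange.addMonoidHom (Int.castAddHom (ZMod (p ^ (n + 1))))
  have hi : ∀ u, i (ρ u) = η u := by
    intro u
    have : i.comp ρ = η := by
      refine Finsupp.addHom_ext fun k a => ?_
      simp [i, ρ, η]
    exact DFunLike.congr_fun this u
  refine ⟨i, fun f hf => ?_⟩
  obtain ⟨u, rfl⟩ : ∃ u, ρ u = f :=
    Finsupp.mapRange_surjective _ (map_zero (Int.castAddHom _)) ZMod.intCast_surjective f
  rw [hi] at hf
  obtain ⟨v, rfl⟩ := hpow u hf (n + 1) le_rfl
  ext k
  have : ((p : ZMod (p ^ (n + 1))) ^ (n + 1)) = 0 := by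
    rw [← Nat.cast_pow, ZMod.natCast_self]
  simp [ρ, this]

theorem exists_injective_disjoint_range_of_relIndex_eq_zero {p n : ℕ} [Fact p.Prime]
    (h : (socleLayer G p (n + 1)).relIndex (socleLayer G p n) = 0) :
    ∃ φ : G →+ G, Function.Injective φ ∧ ∃ B : AddSubgroup G, B ≠ ⊥ ∧ Disjoint φ.range B := by
  have hp : p.Prime := Fact.out
  have : NeZero (p ^ (n + 1)) := ⟨pow_ne_zero _ hp.ne_zero⟩
  obtain ⟨i, hi⟩ := exists_finsupp_zmod_hom h
  obtain ⟨r, hr⟩ := exists_retraction_finsupp_zmod i hi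
  exact exists_injective_disjoint_range (Nat.one_lt_pow n.succ_ne_zero hp.one_lt).ne' i r hr

end Shift

/-! ### Relatively co-Hopfian groups: torsion lies in the image. -/

section CoHopfian

variable {G : Type u} [AddCommGroup G]

open AddCommGroup

theorem IsCoHopfian.isRelativelyCoHopfian (hG : IsCoHopfian G) : IsRelativelyCoHopfian G := by
  intro H A B _ hAB _ hAH
  refine ⟨fun e => hAH (le_antisymm (hAB ▸ le_sup_left) fun x _ => ?_)⟩
  obtain ⟨g, rfl⟩ := hG (A.subtype.comp e.toAddMonoidHom)
    (A.subtype_injective.comp e.injective) x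
  exact (e g).2

/-- The image of an injective endomorphism of a relatively co-Hopfian group is essential. -/
theorem IsRelativelyCoHopfian.eq_bot_of_disjoint_range (hG : IsRelativelyCoHopfian G)
    (φ : G →+ G) (hφ : Function.Injective φ) (B : AddSubgroup G) (hB : Disjoint φ.range B) :
    B = ⊥ := by
  by_contra hne
  -- φ² replaces φ because φ(G) ⊕ B could be all of G; φ²(G) ⊕ B cannot unless φ is surjective.
  have hle : (φ.comp φ).range ≤ φ.range := by
    rintro _ ⟨x, rfl⟩
    exact ⟨φ x, rfl⟩
  refine (hG ((φ.comp φ).range ⊔ B) (φ.comp φ).range B ?_ rfl (hB.mono_left hle) ?_).false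
    (AddMonoidHom.ofInjective (f := φ.comp φ) (hφ.comp hφ))
  · intro htop
    refine hne ?_
    have hsurj : φ.range = ⊤ := by
      rw [eq_top_iff]
      rintro g -
      obtain ⟨_, ⟨h, rfl⟩, b, hb, hg⟩ := AddSubgroup.mem_sup.mp (htop ▸ AddSubgroup.mem_top (φ g))
      have hb' : b ∈ φ.range := ⟨g - φ h, by rw [map_sub, ← hg]; simp⟩
      rw [AddSubgroup.disjoint_def.mp hB hb' hb, add_zero] at hg
      exact ⟨h, hφ hg⟩
    rw [hsurj] at hB
    exact top_disjoint.mp hB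
  · intro hH
    have : B ≤ φ.range := (hH ▸ le_sup_right : B ≤ (φ.comp φ).range).trans hle
    exact hne (hB.eq_bot_of_ge this)

theorem IsRelativelyCoHopfian.socleLayer_zero_le_range (hG : IsRelativelyCoHopfian G)
    (φ : G →+ G) (hφ : Function.Injective φ) {p : ℕ} (hp : p.Prime) :
    socleLayer G p 0 ≤ φ.range := by
  intro b hb
  have hpb : p • b = 0 := hb.1
  by_contra hmem
  have hB := hG.eq_bot_of_disjoint_range φ hφ (AddSubgroup.zmultiples b) (by
    rw [AddSubgroup.disjoint_def]
    intro x hx hxb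
    obtain ⟨m, rfl⟩ := AddSubgroup.mem_zmultiples_iff.mp hxb
    by_cases hpm : (p : ℤ) ∣ m
    · obtain ⟨c, rfl⟩ := hpm
      rw [mul_comm, mul_zsmul', natCast_zsmul, smul_comm, hpb, smul_zero]
    · obtain ⟨s, t, hst⟩ := (Int.prime_iff_natAbs_prime.mpr (by simpa)).coprime_iff_not_dvd.mpr hpm
      refine absurd ?_ hmem
      have : b = t • m • b := by
        rw [smul_smul]
        conv_lhs => rw [← one_zsmul b, ← hst, add_zsmul, mul_zsmul', natCast_zsmul, smul_comm,
          hpb, smul_zero, zero_add]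
      rw [this]
      exact AddSubgroup.zsmul_mem _ hx t)
  rw [AddSubgroup.zmultiples_eq_bot] at hB
  exact hmem (hB ▸ zero_mem _)

theorem IsRelativelyCoHopfian.relIndex_socleLayer_ne_zero (hG : IsRelativelyCoHopfian G)
    {p : ℕ} (hp : p.Prime) (n : ℕ) :
    socleLayer G p n ≤ socleLayer G p 0 ∧
      (socleLayer G p n).relIndex (socleLayer G p 0) ≠ 0 := by
  have : Fact p.Prime := ⟨hp⟩
  induction n with
  | zero => simp
  | succ n ih =>
    refine ⟨(socleLayer_succ_le p n).trans ih.1, ?_⟩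
    rw [← AddSubgroup.relIndex_mul_relIndex _ _ _ (socleLayer_succ_le p n) ih.1]
    refine mul_ne_zero (fun h => ?_) ih.2
    obtain ⟨φ, hφ, B, hB, hd⟩ := exists_injective_disjoint_range_of_relIndex_eq_zero h
    exact hB (hG.eq_bot_of_disjoint_range φ hφ B hd)

theorem map_socleLayer_le (φ : G →+ G) (p n : ℕ) :
    (socleLayer G p n).map φ ≤ socleLayer G p n := by
  rintro _ ⟨x, ⟨hx, y, rfl⟩, rfl⟩
  refine mem_socleLayer.mpr ⟨?_, φ y, (map_nsmul φ _ _).symm⟩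
  rw [← map_nsmul]
  exact (congrArg φ hx).trans (map_zero φ)

/-- φ preserves G[p], so the image of a layer has the same finite index there as the layer
containing it. -/
theorem IsRelativelyCoHopfian.map_socleLayer (hG : IsRelativelyCoHopfian G)
    (φ : G →+ G) (hφ : Function.Injective φ) {p : ℕ} (hp : p.Prime) (n : ℕ) :
    (socleLayer G p n).map φ = socleLayer G p n := by
  have h0 : (socleLayer G p 0).map φ = socleLayer G p 0 := by
    refine le_antisymm (map_socleLayer_le φ p 0) fun x hx => ?_
    obtain ⟨y, rfl⟩ := hG.socleLayer_zero_le_range φ hφ hp hx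
    refine ⟨y, ⟨?_, y, by simp⟩, rfl⟩
    have : p • φ y = 0 := hx.1
    rw [← map_nsmul] at this
    exact (map_eq_zero_iff φ hφ).mp this
  obtain ⟨hle, hfin⟩ := hG.relIndex_socleLayer_ne_zero hp n
  have h1 := AddSubgroup.relIndex_map_map_of_injective (socleLayer G p n) (socleLayer G p 0) hφ
  rw [h0, ← AddSubgroup.relIndex_mul_relIndex _ _ _ (map_socleLayer_le φ p n) hle] at h1
  exact le_antisymm (map_socleLayer_le φ p n)
    (AddSubgroup.relIndex_eq_one.mp (mul_eq_right₀ hfin |>.mp h1))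

/-- The image of an injective endomorphism of a relatively co-Hopfian group contains all torsion
elements. -/
theorem IsRelativelyCoHopfian.torsion_le_range (hG : IsRelativelyCoHopfian G)
    (φ : G →+ G) (hφ : Function.Injective φ) : torsion G ≤ φ.range := by
  have hprime : ∀ p : ℕ, p.Prime → ∀ n : ℕ, ∀ x : G, p ^ n • x = 0 → x ∈ φ.range := by
    intro p hp n
    induction n with
    | zero =>
      intro x hx
      rw [pow_zero, one_nsmul] at hx
      exact hx ▸ zero_mem _
    | succ n ih =>
      intro x hx
      have hmem : p ^ n • x ∈ socleLayer G p n :=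
        mem_socleLayer.mpr ⟨by rw [smul_smul, ← pow_succ', hx], x, rfl⟩
      -- The preimage is again of the form pⁿy, so x − φ(y) is killed by pⁿ.
      rw [← hG.map_socleLayer φ hφ hp n] at hmem
      obtain ⟨_, ⟨-, y, rfl⟩, hy⟩ := hmem
      rw [nsmulAddMonoidHom_apply, map_nsmul] at hy
      have := ih (x - φ y) (by rw [nsmul_sub, hy, sub_self])
      simpa using add_mem this (⟨y, rfl⟩ : φ y ∈ φ.range)
  have hall : ∀ m : ℕ, m ≠ 0 → ∀ x : G, m • x = 0 → x ∈ φ.range := by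
    intro m
    induction m using Nat.recOnPosPrimePosCoprime with
    | prime_pow p n hp hn => exact fun _ => hprime p hp n
    | zero => exact fun h => absurd rfl h
    | one =>
      intro _ x hx
      rw [one_nsmul] at hx
      exact hx ▸ zero_mem _
    | coprime a b ha hb hab iha ihb =>
      intro _ x hx
      obtain ⟨s, t, hst⟩ := Nat.isCoprime_iff_coprime.mpr hab
      have h1 : a • x ∈ φ.range := ihb (by omega) _ (by rw [smul_smul, mul_comm, hx])
      have h2 : b • x ∈ φ.range := iha (by omega) _ (by rw [smul_smul, hx])
      have : x = s • a • x + t • b • x := by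
        rw [← natCast_zsmul x a, ← natCast_zsmul x b, smul_smul, smul_smul, ← add_zsmul, hst,
          one_zsmul]
      rw [this]
      exact add_mem (AddSubgroup.zsmul_mem _ h1 s) (AddSubgroup.zsmul_mem _ h2 t)
  intro x hx
  obtain ⟨m, hm, hmx⟩ := (isOfFinAddOrder_iff_nsmul_eq_zero).mp hx
  exact hall m hm.ne' x hmx

/-! ### Passing between G and its torsion subgroup. -/

namespace IsAdjustedCotorsion

theorem surjective_of_torsion_le_range (hG : IsAdjustedCotorsion G) (φ : G →+ G)
    (hφ : Function.Injective φ) (hT : torsion G ≤ φ.range) : Function.Surjective φ := by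
  have h0 := (isReducedAb_quotient_range hG.cotorsion hG.reduced φ hφ).hom_eq_zero
    hG.divisible_quotient_torsion (QuotientAddGroup.map _ _ (AddMonoidHom.id G) hT)
  intro x
  exact (QuotientAddGroup.eq_zero_iff x).mp
    (DFunLike.congr_fun h0 (QuotientAddGroup.mk' (torsion G) x))

theorem exists_extension (hG : IsAdjustedCotorsion G) (φ : torsion G →+ torsion G) :
    ∃ Φ : G →+ G, ∀ x : torsion G, Φ x = φ x := by
  obtain ⟨Φ, hΦ⟩ := exists_extension_of_subsingleton_ext (torsion G).subtype
    (QuotientAddGroup.mk' (torsion G)) (by intro y; simp)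
    (torsion G).subtype_injective (QuotientAddGroup.mk'_surjective _)
    (hG.cotorsion _ isAddTorsionFree_quotient_torsion) ((torsion G).subtype.comp φ)
  exact ⟨Φ, fun x => DFunLike.congr_fun hΦ x⟩

/-- Φ⁻¹(T)/T is divisible because G/T is, and it maps to the reduced group T/φ(T), so that map is
zero. -/
theorem map_mem_map_torsion (hG : IsAdjustedCotorsion G) (φ : torsion G →+ torsion G)
    (hr : IsReducedAb (torsion G ⧸ φ.range)) (Φ : G →+ G) (hΦ : ∀ x : torsion G, Φ x = φ x)
    (x : G) (hx : Φ x ∈ torsion G) : ∃ t : torsion G, Φ x = φ t := by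
  let P : AddSubgroup G := (torsion G).comap Φ
  let f : P →+ torsion G ⧸ φ.range :=
    (QuotientAddGroup.mk' _).comp ((Φ.comp P.subtype).codRestrict (torsion G) fun x => x.2)
  have hf : ∀ t : P, (t : G) ∈ torsion G → f t = 0 := fun t ht =>
    (QuotientAddGroup.eq_zero_iff _).mpr ⟨⟨t, ht⟩, Subtype.ext (hΦ ⟨t, ht⟩).symm⟩
  have hbot := hr.eq_bot f.range (by
    rintro n hn _ ⟨y, rfl⟩
    obtain ⟨z, hz⟩ := hG.divisible_quotient_torsion n hn (QuotientAddGroup.mk' _ (y : G))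
    obtain ⟨z, rfl⟩ := QuotientAddGroup.mk'_surjective _ z
    rw [← map_nsmul, eq_comm, ← sub_eq_zero, ← map_sub] at hz
    have ht : (y : G) - n • z ∈ torsion G := (QuotientAddGroup.eq_zero_iff _).mp hz
    have htP : (y : G) - n • z ∈ P := by
      change Φ _ ∈ torsion G
      rw [show Φ _ = _ from hΦ ⟨_, ht⟩]
      exact (φ ⟨_, ht⟩).2
    have hzP : z ∈ P := by
      have h1 := sub_mem y.2 htP
      rw [sub_sub_cancel] at h1
      change Φ _ ∈ torsion G at h1
      rw [map_nsmul] at h1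
      exact mem_torsion_of_nsmul_mem hn h1
    refine ⟨f ⟨z, hzP⟩, ⟨_, rfl⟩, ?_⟩
    rw [← map_nsmul, eq_comm, ← sub_eq_zero, ← map_sub]
    exact hf _ ht)
  have h0 : f ⟨x, hx⟩ = 0 := DFunLike.congr_fun (f.range_eq_bot_iff.mp hbot) _
  obtain ⟨t, ht⟩ := (QuotientAddGroup.eq_zero_iff _).mp h0
  exact ⟨t, (congrArg Subtype.val ht).symm⟩

/-- The kernel is divisible: a quotient modulo torsion can be corrected by a torsion element to lie
in it, and it contains no torsion because φ is injective. -/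
theorem injective_of_extension (hG : IsAdjustedCotorsion G) (φ : torsion G →+ torsion G)
    (hφ : Function.Injective φ) (hr : IsReducedAb (torsion G ⧸ φ.range)) (Φ : G →+ G)
    (hΦ : ∀ x : torsion G, Φ x = φ x) : Function.Injective Φ := by
  rw [← Φ.ker_eq_bot_iff]
  refine hG.reduced.eq_bot _ fun n hn x hx => ?_
  obtain ⟨y, hy⟩ := hG.divisible_quotient_torsion n hn (QuotientAddGroup.mk' _ x)
  obtain ⟨y, rfl⟩ := QuotientAddGroup.mk'_surjective _ y
  rw [← map_nsmul, eq_comm, ← sub_eq_zero, ← map_sub] at hy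
  have ht : x - n • y ∈ torsion G := (QuotientAddGroup.eq_zero_iff _).mp hy
  rw [AddMonoidHom.mem_ker] at hx
  have h1 : Φ (x - n • y) = φ ⟨_, ht⟩ := hΦ ⟨_, ht⟩
  have h2 : Φ y ∈ torsion G := by
    refine mem_torsion_of_nsmul_mem hn ?_
    have := neg_mem (φ ⟨_, ht⟩).2
    rwa [← h1, map_sub, hx, zero_sub, neg_neg, map_nsmul] at this
  obtain ⟨t, hyt⟩ := hG.map_mem_map_torsion φ hr Φ hΦ y h2
  have hk : y - t ∈ Φ.ker := by rw [AddMonoidHom.mem_ker, map_sub, hyt, hΦ, sub_self]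
  refine ⟨y - t, hk, ?_⟩
  -- the difference is a torsion element of the kernel
  have hd : x - n • (y - t) ∈ torsion G := by
    rw [nsmul_sub, ← sub_add, add_comm]
    exact add_mem (AddSubgroup.nsmul_mem _ t.2 n) ht
  have hd0 : φ ⟨_, hd⟩ = 0 := by
    ext
    rw [← hΦ]
    change Φ (x - n • (y - t)) = 0
    rw [map_sub, hx, map_nsmul, AddMonoidHom.mem_ker.mp hk, smul_zero, sub_zero]
  have hd1 := congrArg Subtype.val ((map_eq_zero_iff φ hφ).mp hd0)
  exact (sub_eq_zero.mp hd1).symm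

theorem isCoHopfian_of_isRelativelyCoHopfian (hG : IsAdjustedCotorsion G)
    (h : IsRelativelyCoHopfian G) : IsCoHopfian G := fun φ hφ =>
  hG.surjective_of_torsion_le_range φ hφ (h.torsion_le_range φ hφ)

theorem isQuotientReducedCoHopfian_torsion (hG : IsAdjustedCotorsion G) (h : IsCoHopfian G) :
    IsQuotientReducedCoHopfian (torsion G) := by
  intro φ hφ hr t
  obtain ⟨Φ, hΦ⟩ := hG.exists_extension φ
  have hinj := hG.injective_of_extension φ hφ hr Φ hΦ
  obtain ⟨g, hg⟩ := h Φ hinj t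
  obtain ⟨s, hs⟩ := hG.map_mem_map_torsion φ hr Φ hΦ g (hg ▸ t.2)
  exact ⟨s, Subtype.ext (hs.symm.trans hg)⟩

theorem isCoHopfian_of_torsion (hG : IsAdjustedCotorsion G)
    (h : IsQuotientReducedCoHopfian (torsion G)) : IsCoHopfian G := by
  intro Φ hΦ
  have hmap : ∀ x : torsion G, Φ x ∈ torsion G := fun x => Φ.isOfFinAddOrder x.2
  let φ : torsion G →+ torsion G := (Φ.comp (torsion G).subtype).codRestrict (torsion G) hmap
  have hφ : Function.Injective φ := fun a b hab =>
    Subtype.ext (hΦ (congrArg Subtype.val hab))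
  -- Since Φ preserves orders, T/φ(T) embeds in the reduced group G/Φ(G).
  let j : torsion G ⧸ φ.range →+ G ⧸ Φ.range :=
    QuotientAddGroup.map _ _ (torsion G).subtype (by
      rintro _ ⟨x, rfl⟩
      exact ⟨x, rfl⟩)
  have hj : Function.Injective j := by
    rw [injective_iff_map_eq_zero]
    intro x hx
    obtain ⟨x, rfl⟩ := QuotientAddGroup.mk'_surjective _ x
    obtain ⟨g, hg⟩ := (QuotientAddGroup.eq_zero_iff (x : G)).mp hx
    have hgT : g ∈ torsion G := (hΦ.isOfFinAddOrder_iff).mp (hg ▸ x.2)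
    exact (QuotientAddGroup.eq_zero_iff _).mpr ⟨⟨g, hgT⟩, Subtype.ext hg⟩
  have hred : IsReducedAb (torsion G ⧸ φ.range) := by
    refine isReducedAb_of_hom_rat.{u} fun f => ?_
    have h0 := (isReducedAb_quotient_range hG.cotorsion hG.reduced Φ hΦ).hom_eq_zero
      ULift.rat_divisible (j.comp f)
    ext x
    exact (map_eq_zero_iff j hj).mp (DFunLike.congr_fun h0 x)
  refine hG.surjective_of_torsion_le_range Φ hΦ fun t ht => ?_
  obtain ⟨s, hs⟩ := h φ hφ hred ⟨t, ht⟩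
  exact ⟨s, congrArg Subtype.val hs⟩

end IsAdjustedCotorsion

end CoHopfian

/-- For an adjusted cotorsion group `G` with torsion subgroup `T`, one has `G ≅ Ext(ℚ/ℤ, T)`,
and `G` is co-Hopfian iff it is relatively co-Hopfian iff `T` is quotient reduced co-Hopfian. -/
theorem proposition2p34 (G : Type u) [AddCommGroup G] (hG : IsAdjustedCotorsion G) :
    Nonempty (G ≃+ ExtAb QModZ.{u} (AddCommGroup.torsion G)) ∧
      List.TFAE [
        IsCoHopfian G,
        IsRelativelyCoHopfian G,
        IsQuotientReducedCoHopfian (AddCommGroup.torsion G)] := by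
  refine ⟨hG.nonempty_addEquiv_ext, ?_⟩
  tfae_have 1 → 2 := IsCoHopfian.isRelativelyCoHopfian
  tfae_have 2 → 1 := hG.isCoHopfian_of_isRelativelyCoHopfian
  tfae_have 1 → 3 := hG.isQuotientReducedCoHopfian_torsion
  tfae_have 3 → 1 := hG.isCoHopfian_of_torsion
  tfae_finish
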